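/- **Theorem 5 (random harmonic oscillators).** Let $c,\lambda>0$. Let $V(0)$ be uniformly distributed on $\{-c,c\}$, let $N$ be a homogeneous Poisson process with rate $\lambda$, independent of $V(0)$ (that is, the waiting times between its events are i.i.d. exponential with parameter $\lambda$), and put $V(t)=V(0)(-1)^{N(t)}$, $X(t)=\int_0^tV(s)\,\mathrm ds$ (the telegraph process), $Z_1(t)=\cos X(t)$, $Z_2(t)=\sin X(t)$. Let $$\mu(x,t)=\frac{\lambda e^{-\lambda t}}{2}\left[\frac1c I_0\!\left(\frac\lambda c\sqrt{c^2t^2-x^2}\right)+t\,\frac{I_1\!\left(\frac\lambda c\sqrt{c^2t^2-x^2}\right)}{\sqrt{c^2t^2-x^2}}\right],\qquad |x|<ct,$$ where $I_n(x)=\sum_{k\ge0}\frac{(x/2)^{n+2k}}{k!\,\Gamma(k+n+1)}$. For every $t\ge0$ the law of $X(t)$ is $$p(\mathrm dx,t)=\tfrac12e^{-\lambda t}[\delta_{-ct}(\mathrm dx)+\delta_{ct}(\mathrm dx)]+\mu(x,t)\mathbf 1_{|x|<ct}\,\mathrm dx.$$ Let $F_X(x,t)=\mathbb P(X(t)\le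 x)$ be its distribution function and $F_X(x^-,t)$ the left limit of $F_X(\cdot,t)$ at $x$. Then the following holds for every $t\ge0$. 1) For every $x\in[-1,1]$ with $x\ne\cos ct$, and also for $x=1$, $$\mathbb P(Z_1(t)\le x)=\sum_{k=-\infty}^{\infty}\left[F_X((2k+2)\pi-\arccos x,t)-F_X(\arccos x+2k\pi,t)\right];$$ for every $x\in[-1,1)$, including $x=\cos ct$, the same equality holds with $F_X(\arccos x+2k\pi,t)$ replaced by the left limit $F_X((\arccos x+2k\pi)^-,t)$. Furthermore $$\mathbb P(Z_1(t)\in\mathrm dx)=e^{-\lambda t}\delta_{\cos ct}(\mathrm dx)+\nu(x,t)\mathbf 1_{|x|<1}\,\mathrm dx,$$ where, for $|x|<1$, the density $\nu\ge0$ of the absolutely continuous part, integrable on $(-1,1)$, is given by the convergent series $$\nu(x,t)=\frac1{\sqrt{1-x^2}}\sum_{k=-\infty}^{\infty}\left[\mu((2k+2)\pi-\arccos x,t)\mathbf 1_{|(2k+2)\pi-\arccos x|<ct}+\mu(\arccos x+2k\pi,t)\mathbf 1_{|\arccos x+2k\pi|<ct}\right].$$ 2) For every $x\in[-1,1]$ with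 $x\notin\{\sin ct,-\sin ct\}$, and also for $x=1$ and, if $\cos ct>0$, for all $x\in[-1,1]$, $$\mathbb P(Z_2(t)\le x)=\sum_{k=-\infty}^{\infty}\left[F_X(\arcsin x+2k\pi,t)-F_X((2k-\tfrac12)\pi,t)+F_X((2k+\tfrac32)\pi,t)-F_X((2k+1)\pi-\arcsin x,t)\right];$$ for every $x\in[-1,1)$ the same equality holds with $F_X((2k+1)\pi-\arcsin x,t)$ replaced by the left limit $F_X(((2k+1)\pi-\arcsin x)^-,t)$. Furthermore $$\mathbb P(Z_2(t)\in\mathrm dx)=\tfrac12e^{-\lambda t}[\delta_{\sin ct}(\mathrm dx)+\delta_{-\sin ct}(\mathrm dx)]+\eta(x,t)\mathbf 1_{|x|<1}\,\mathrm dx,$$ where, for $|x|<1$, the density $\eta\ge0$ of the absolutely continuous part, integrable on $(-1,1)$, is given by the convergent series $$\eta(x,t)=\frac1{\sqrt{1-x^2}}\sum_{k=-\infty}^{\infty}\left[\mu(\arcsin x+2k\pi,t)\mathbf 1_{|\arcsin x+2k\pi|<ct}+\mu((2k+1)\pi-\arcsin x,t)\mathbf 1_{|(2k+1)\pi-\arcsin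 x|<ct}\right].$$ -/

import Mathlib

open Real MeasureTheory ProbabilityTheory

noncomputable section

namespace Telegraph

variable {Ω : Type*}

/-- The `n`-th event time `T n = τ 0 + ... + τ (n - 1)` of the sequence of waiting times `τ`;
`T 0 = 0`. -/
def eventTime (τ : ℕ → Ω → ℝ) (n : ℕ) (ω : Ω) : ℝ :=
  ∑ i ∈ Finset.range n, τ i ω

/-- The number `N t` of events in `(0, t]`. -/
def count (τ : ℕ → Ω → ℝ) (t : ℝ) (ω : Ω) : ℕ :=
  Set.ncard {n : ℕ | 1 ≤ n ∧ eventTime τ n ω ≤ t}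

/-- The velocity `V t = V 0 * (-1) ^ N t`. -/
def velocity (V₀ : Ω → ℝ) (τ : ℕ → Ω → ℝ) (t : ℝ) (ω : Ω) : ℝ :=
  V₀ ω * (-1) ^ count τ t ω

/-- The position `X t = ∫₀ᵗ V s ds`. -/
def position (V₀ : Ω → ℝ) (τ : ℕ → Ω → ℝ) (t : ℝ) (ω : Ω) : ℝ :=
  ∫ s in (0 : ℝ)..t, velocity V₀ τ s ω

/-- The horizontal oscillator `Z₁ t = cos (X t)`. -/
def oscillatorCos (V₀ : Ω → ℝ) (τ : ℕ → Ω → ℝ) (t : ℝ) (ω : Ω) : ℝ :=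
  cos (position V₀ τ t ω)

/-- The vertical oscillator `Z₂ t = sin (X t)`. -/
def oscillatorSin (V₀ : Ω → ℝ) (τ : ℕ → Ω → ℝ) (t : ℝ) (ω : Ω) : ℝ :=
  sin (position V₀ τ t ω)

/-- The randomness that drives the symmetric telegraph process with speed `c` and rate `lam`:
the initial velocity is uniform on `{-c, c}`, and it is independent of the waiting times, which
are i.i.d. exponential with rate `lam` (so that `count τ` is the homogeneous Poisson process with
rate `lam`). -/
structure IsDriver [MeasurableSpace Ω] (P : Measure Ω) (c lam : ℝ) (V₀ : Ω → ℝ)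
    (τ : ℕ → Ω → ℝ) : Prop where
  law_velocity : HasLaw V₀
    (ENNReal.ofReal (1 / 2) • (Measure.dirac (-c) + Measure.dirac c)) P
  law_waiting : ∀ i, HasLaw (τ i) (expMeasure lam) P
  indep_waiting : iIndepFun τ P
  indep : IndepFun V₀ (fun ω i => τ i ω) P

/-- The cumulative distribution function `F_X(x, t)` of `X t`. -/
def positionCDF [MeasurableSpace Ω] (P : Measure Ω) (V₀ : Ω → ℝ) (τ : ℕ → Ω → ℝ) (x t : ℝ) : ℝ :=
  cdf (P.map (position V₀ τ t)) x

/-- The left limit `F_X(x-, t)` of `F_X(·, t)` at `x`. -/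
def positionCDFLeft [MeasurableSpace Ω] (P : Measure Ω) (V₀ : Ω → ℝ) (τ : ℕ → Ω → ℝ)
    (x t : ℝ) : ℝ :=
  Function.leftLim (fun y => positionCDF P V₀ τ y t) x

/-- The modified Bessel function `I_n` of the first kind, of integer order `n ≥ 0`. -/
def besselI (n : ℕ) (x : ℝ) : ℝ :=
  ∑' k : ℕ, (x / 2) ^ (n + 2 * k) / (k.factorial * Real.Gamma (k + n + 1))

/-- The function `μ(x, t)`; it is used for `|x| < c t` only. -/
def mu (c lam x t : ℝ) : ℝ :=
  lam * exp (-lam * t) / 2 *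
    (1 / c * besselI 0 (lam / c * √(c ^ 2 * t ^ 2 - x ^ 2)) +
      t * (besselI 1 (lam / c * √(c ^ 2 * t ^ 2 - x ^ 2)) / √(c ^ 2 * t ^ 2 - x ^ 2)))

/-- The function `μ(x, t) 1_{|x| < c t}`. -/
def muCut (c lam x t : ℝ) : ℝ :=
  Set.indicator {y : ℝ | |y| < c * t} (fun y => mu c lam y t) x

/-- The measure `p(dx, t) = (1/2) e^{-lam t} (δ_{-ct} + δ_{ct})(dx) + μ(x, t) 1_{|x| < ct} dx`. -/
def law (c lam t : ℝ) : Measure ℝ :=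
  ENNReal.ofReal (exp (-lam * t) / 2) • (Measure.dirac (-(c * t)) + Measure.dirac (c * t)) +
    volume.withDensity (fun x => ENNReal.ofReal (muCut c lam x t))

/-- The `k`-th term of the series in the density of `Z₁ t`. -/
def nuTerm (c lam x t : ℝ) (k : ℤ) : ℝ :=
  muCut c lam ((2 * k + 2) * π - arccos x) t + muCut c lam (arccos x + 2 * k * π) t

/-- The density `ν(x, t)`, for `|x| < 1`. -/
def nu (c lam x t : ℝ) : ℝ :=
  1 / √(1 - x ^ 2) * ∑' k : ℤ, nuTerm c lam x t k

/-- The `k`-th term of the series in the density of `Z₂ t`. -/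
def etaTerm (c lam x t : ℝ) (k : ℤ) : ℝ :=
  muCut c lam (arcsin x + 2 * k * π) t + muCut c lam ((2 * k + 1) * π - arcsin x) t

/-- The density `η(x, t)`, for `|x| < 1`. -/
def eta (c lam x t : ℝ) : ℝ :=
  1 / √(1 - x ^ 2) * ∑' k : ℤ, etaTerm c lam x t k

/-- The measure `f(x) 1_{|x| < 1} dx`. -/
def densityMeasure (f : ℝ → ℝ) : Measure ℝ :=
  volume.withDensity (Set.indicator (Set.Ioo (-1) 1) (fun x => ENNReal.ofReal (f x)))

end Telegraph

end

/-! On the event of exactly `n` events in `(0, t]` the particle moves at constant speed and reverses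
`n` times, so its position is `V₀ (-1)^n (t - 2 B)`, where `B` is the time spent against the final
direction (`position_eq`). `B` is a sum of `(n + 1) / 2` whole waiting times, hence Erlang. Given `B
= b`, having exactly `n` events means that the other `n / 2` whole waiting times fit into `t - b`
while the next one overshoots it, which has a Poisson probability (`lintegral_countEvent`).

For `n = 0` this gives the two atoms. The contributions of `2 k + 1` and `2 k + 2` events, taken
together and symmetrised in `b ↔ t - b`, are products of Poisson weights. Under `x = c (t - 2 b)`
their sum over `k` is the pair of Bessel series in `mu` (`tsum_poissonWeight_mul`), whence
`hasLaw_position`.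

The rest concerns pushing this law forward by `cos` and `sin`. The line is cut into half-open
periods: in each, a sublevel set is one or two intervals, measured by the distribution function, and
the density is transported by the two inverse branches. The only delicate points are the atoms at `±
c t`, which matter when they hit a closed left endpoint. -/

namespace Telegraph

section

open scoped ENNReal

/-! ### Poisson weights and Erlang laws. -/

/-- The probability that a Poisson process with rate `lam` has exactly `k` events in `(0, s]`,
extended by `0` to negative `s`. -/
noncomputable def poissonWeight (lam : ℝ) (k : ℕ) (s : ℝ) : ℝ≥0∞ :=
  if 0 ≤ s then ENNReal.ofReal (exp (-lam * s) * (lam * s) ^ k / k.factorial) else 0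

/-- The Erlang distribution: the law of a sum of `k` independent exponential variables. -/
noncomputable def erlang (lam : ℝ) : ℕ → Measure ℝ
  | 0 => Measure.dirac 0
  | k + 1 => volume.withDensity (fun s => ENNReal.ofReal lam * poissonWeight lam k s)

@[fun_prop]
lemma measurable_poissonWeight (lam : ℝ) (k : ℕ) : Measurable (poissonWeight lam k) := by
  unfold poissonWeight
  refine Measurable.ite measurableSet_Ici ?_ measurable_const
  fun_prop

lemma poissonWeight_of_nonneg {lam s : ℝ} (hs : 0 ≤ s) (k : ℕ) :
    poissonWeight lam k s = ENNReal.ofReal (exp (-lam * s) * (lam * s) ^ k / k.factorial) :=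
  if_pos hs

lemma poissonWeight_of_neg {lam s : ℝ} (hs : s < 0) (k : ℕ) : poissonWeight lam k s = 0 :=
  if_neg hs.not_ge

lemma expMeasure_eq_withDensity {lam : ℝ} (hlam : 0 < lam) :
    expMeasure lam =
      volume.withDensity (fun s => ENNReal.ofReal lam * poissonWeight lam 0 s) := by
  change volume.withDensity (exponentialPDF lam) = _
  congr 1
  ext s
  rw [exponentialPDF_eq]
  by_cases hs : 0 ≤ s
  · rw [if_pos hs, poissonWeight_of_nonneg hs, ← ENNReal.ofReal_mul hlam.le]
    simp
  · rw [if_neg hs, poissonWeight_of_neg (not_le.1 hs)]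
    simp

instance sFinite_erlang (lam : ℝ) (k : ℕ) : SFinite (erlang lam k) := by
  cases k <;> · unfold erlang; infer_instance

lemma expMeasure_Ioi {lam : ℝ} (hlam : 0 < lam) {s : ℝ} (hs : 0 ≤ s) :
    expMeasure lam (Set.Ioi s) = poissonWeight lam 0 s := by
  have := isProbabilityMeasure_expMeasure hlam
  rw [← Set.compl_Iic, prob_compl_eq_one_sub measurableSet_Iic, ← ofReal_cdf,
    cdf_expMeasure_eq hlam, if_pos hs, poissonWeight_of_nonneg hs, ← ENNReal.ofReal_one,
    ← ENNReal.ofReal_sub]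
  · simp
  · simp only [sub_nonneg, exp_le_one_iff, neg_nonpos]
    positivity

/-- Conditioning on the time `a` of the `k`-th event: exactly `k` events by time `s` means `a ≤ s`
and no further event during `s - a`. In the computation the exponentials merge, and only a power of
`a` is left to integrate over `[0, s]`. -/
lemma lintegral_poissonWeight_zero_erlang {lam : ℝ} (hlam : 0 < lam) (k : ℕ) (s : ℝ) :
    ∫⁻ a, poissonWeight lam 0 (s - a) ∂(erlang lam k) = poissonWeight lam k s := by
  cases k with
  | zero => simp [erlang]
  | succ k =>
    rw [erlang, lintegral_withDensity_eq_lintegral_mul _ (by fun_prop) (by fun_prop)]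
    simp only [Pi.mul_apply]
    by_cases hs : 0 ≤ s
    · set C : ℝ := exp (-lam * s) * lam ^ (k + 1) / k.factorial with hC
      have hC0 : 0 ≤ C := by positivity
      have h : ∀ a, ENNReal.ofReal lam * poissonWeight lam k a * poissonWeight lam 0 (s - a) =
          (Set.Icc 0 s).indicator (fun a => ENNReal.ofReal (C * a ^ k)) a := by
        intro a
        by_cases ha : 0 ≤ a
        · by_cases has : a ≤ s
          · rw [Set.indicator_of_mem (show a ∈ Set.Icc 0 s from ⟨ha, has⟩),
              poissonWeight_of_nonneg ha, poissonWeight_of_nonneg (sub_nonneg.2 has),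
              ← ENNReal.ofReal_mul hlam.le, ← ENNReal.ofReal_mul (by positivity)]
            congr 1
            have : exp (-lam * s) = exp (-lam * a) * exp (-lam * (s - a)) := by
              rw [← exp_add]; ring_nf
            rw [hC, this]
            simp
            ring
          · rw [Set.indicator_of_notMem (by simp [has]),
              poissonWeight_of_neg (sub_neg.2 (not_le.1 has)), mul_zero]
        · rw [Set.indicator_of_notMem (by simp [ha]), poissonWeight_of_neg (not_le.1 ha)]
          simp
      simp_rw [h]
      rw [lintegral_indicator measurableSet_Icc, ← ofReal_integral_eq_lintegral_ofReal,
        integral_Icc_eq_integral_Ioc, ← intervalIntegral.integral_of_le hs,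
        poissonWeight_of_nonneg hs]
      · congr 1
        rw [intervalIntegral.integral_const_mul, integral_pow, hC, Nat.factorial_succ]
        push_cast
        field_simp
        ring
      · exact (Continuous.continuousOn (by fun_prop)).integrableOn_Icc
      · filter_upwards [ae_restrict_mem measurableSet_Icc] with a ha
        exact mul_nonneg hC0 (pow_nonneg ha.1 _)
    · rw [poissonWeight_of_neg (not_le.1 hs)]
      refine (lintegral_congr fun a => ?_).trans lintegral_zero
      by_cases ha : 0 ≤ a
      · rw [poissonWeight_of_neg (s := s - a) (by linarith [not_le.1 hs]), mul_zero]
      · rw [poissonWeight_of_neg (not_le.1 ha)]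
        simp

lemma lintegral_expMeasure_add {lam : ℝ} (hlam : 0 < lam) {g : ℝ → ℝ≥0∞} (hg : Measurable g)
    (a : ℝ) : ∫⁻ y, g (a + y) ∂(expMeasure lam) =
      ∫⁻ s, ENNReal.ofReal lam * poissonWeight lam 0 (s - a) * g s := by
  rw [expMeasure_eq_withDensity hlam,
    lintegral_withDensity_eq_lintegral_mul _ (by fun_prop) (by fun_prop)]
  rw [← lintegral_add_left_eq_self
    (fun s => ENNReal.ofReal lam * poissonWeight lam 0 (s - a) * g s) a]
  simp

/-- After exchanging the integrals, the density of the convolution at `s` is `lam` times the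
integral in `lintegral_poissonWeight_zero_erlang`. -/
lemma erlang_conv_expMeasure {lam : ℝ} (hlam : 0 < lam) (k : ℕ) :
    erlang lam k ∗ expMeasure lam = erlang lam (k + 1) := by
  have := isProbabilityMeasure_expMeasure hlam
  refine Measure.ext_of_lintegral _ fun g hg => ?_
  rw [Measure.lintegral_conv hg]
  simp_rw [lintegral_expMeasure_add hlam hg]
  rw [lintegral_lintegral_swap (by fun_prop), erlang,
    lintegral_withDensity_eq_lintegral_mul _ (by fun_prop) hg]
  refine lintegral_congr fun s => ?_
  rw [lintegral_mul_const _ (by fun_prop), lintegral_const_mul _ (by fun_prop),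
    lintegral_poissonWeight_zero_erlang hlam, Pi.mul_apply]

/-- The inner integral is the exponential tail beyond `s - a`, which reduces the claim to
`lintegral_poissonWeight_zero_erlang`. -/
lemma lintegral_indicator_expMeasure {lam : ℝ} (hlam : 0 < lam) (k : ℕ) (s : ℝ) :
    ∫⁻ a, (∫⁻ y, {q : ℝ × ℝ | q.1 ≤ s ∧ s < q.1 + q.2}.indicator 1 (a, y) ∂(expMeasure lam))
      ∂(erlang lam k) = poissonWeight lam k s := by
  rw [← lintegral_poissonWeight_zero_erlang hlam]
  refine lintegral_congr fun a => ?_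
  by_cases ha : a ≤ s
  · rw [← expMeasure_Ioi hlam (sub_nonneg.2 ha), ← lintegral_indicator_one measurableSet_Ioi]
    refine lintegral_congr fun y => ?_
    simp only [Set.indicator, Set.mem_ofPred_eq, Set.mem_Ioi, ha, true_and, sub_lt_iff_lt_add',
      Pi.one_apply]
  · rw [poissonWeight_of_neg (sub_neg.2 (not_le.1 ha))]
    simp [ha]

lemma tsum_poissonWeight {lam t : ℝ} (hlam : 0 < lam) (ht : 0 ≤ t) :
    ∑' k, poissonWeight lam k t = 1 := by
  have h : HasSum (fun k : ℕ => exp (-lam * t) * (lam * t) ^ k / k.factorial) 1 := by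
    have := (NormedSpace.expSeries_div_hasSum_exp (lam * t)).mul_left (exp (-lam * t))
    rw [← Real.exp_eq_exp_ℝ, ← exp_add] at this
    simpa [mul_div_assoc] using this
  simp_rw [poissonWeight_of_nonneg ht]
  rw [← ENNReal.ofReal_tsum_of_nonneg (fun k => by positivity) h.summable, h.tsum_eq]
  simp

/-! ### Waiting times split by parity: motion along and against the final direction. -/

/-- The indices `i < n` of the same parity as `n`. -/
def sameParity (n : ℕ) : Finset ℕ := (Finset.range n).filter fun i => Even (n + i)

/-- The indices `i < n` whose parity differs from that of `n`. -/
def otherParity (n : ℕ) : Finset ℕ := (Finset.range n).filter fun i => ¬ Even (n + i)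

lemma sameParity_succ (n : ℕ) : sameParity (n + 1) = otherParity n := by
  ext i
  simp only [sameParity, otherParity, Finset.mem_filter, Finset.mem_range]
  grind

lemma otherParity_succ (n : ℕ) : otherParity (n + 1) = insert n (sameParity n) := by
  ext i
  simp only [sameParity, otherParity, Finset.mem_filter, Finset.mem_range, Finset.mem_insert]
  grind

lemma notMem_sameParity (n : ℕ) : n ∉ sameParity n := by simp [sameParity]

lemma notMem_otherParity (n : ℕ) : n ∉ otherParity n := by simp [otherParity]

lemma disjoint_otherParity_insert (n : ℕ) :
    Disjoint (otherParity n) (insert n (sameParity n)) := by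
  rw [Finset.disjoint_insert_right]
  exact ⟨notMem_otherParity n, (Finset.disjoint_filter_filter_not _ _ _).symm⟩

lemma card_parity (n : ℕ) :
    (sameParity n).card = n / 2 ∧ (otherParity n).card = (n + 1) / 2 := by
  induction n with
  | zero => simp [sameParity, otherParity]
  | succ n ih =>
    rw [sameParity_succ, otherParity_succ, Finset.card_insert_of_notMem (notMem_sameParity n),
      ih.1, ih.2]
    omega

lemma sum_parity (w : ℕ → ℝ) (n : ℕ) :
    ∑ i ∈ sameParity n, w i + ∑ i ∈ otherParity n, w i = ∑ i ∈ Finset.range n, w i :=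
  Finset.sum_filter_add_sum_filter_not _ _ _

lemma sum_otherParity_succ (w : ℕ → ℝ) (n : ℕ) :
    ∑ i ∈ otherParity (n + 1), w i =
      ∑ i ∈ Finset.range (n + 1), w i - ∑ i ∈ otherParity n, w i := by
  rw [otherParity_succ, Finset.sum_insert (notMem_sameParity n), Finset.sum_range_succ,
    ← sum_parity]
  ring

/-! ### Pathwise formula for the position. -/

section Path

variable {Ω : Type*} {τ : ℕ → Ω → ℝ} {ω : Ω}

lemma eventTime_mono (hτ : ∀ i, 0 ≤ τ i ω) : Monotone fun n => eventTime τ n ω :=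
  monotone_nat_of_le_succ fun n => by
    simp only [eventTime, Finset.sum_range_succ]
    linarith [hτ n]

lemma count_eq (hτ : ∀ i, 0 ≤ τ i ω) {n : ℕ} {s : ℝ} (h1 : eventTime τ n ω ≤ s)
    (h2 : s < eventTime τ (n + 1) ω) : count τ s ω = n := by
  have : {m : ℕ | 1 ≤ m ∧ eventTime τ m ω ≤ s} = (Finset.Icc 1 n : Finset ℕ) := by
    ext m
    simp only [Set.mem_ofPred_eq, Finset.coe_Icc, Set.mem_Icc, and_congr_right_iff]
    refine fun _ => ⟨fun h => ?_, fun h => (eventTime_mono hτ h).trans h1⟩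
    by_contra hm
    exact absurd (h2.trans_le (eventTime_mono hτ (not_le.1 hm : n + 1 ≤ m))) h.not_gt
  rw [count, this, Set.ncard_coe_finset]
  simp

/-- The velocity is constant between consecutive events. The endpoint `u = T (n + 1)`, where it may
jump, is allowed because a point is null; the induction over events needs that case. -/
lemma velocity_intervalIntegral (V₀ : Ω → ℝ) (hτ : ∀ i, 0 ≤ τ i ω) {n : ℕ} {u : ℝ}
    (h1 : eventTime τ n ω ≤ u) (h2 : u ≤ eventTime τ (n + 1) ω) :
    IntervalIntegrable (fun s => velocity V₀ τ s ω) volume (eventTime τ n ω) u ∧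
      ∫ s in (eventTime τ n ω)..u, velocity V₀ τ s ω =
        V₀ ω * (-1) ^ n * (u - eventTime τ n ω) := by
  have h : (fun _ => V₀ ω * (-1) ^ n) =ᵐ[volume.restrict (Set.uIoc (eventTime τ n ω) u)]
      (fun s => velocity V₀ τ s ω) := by
    rw [Set.uIoc_of_le h1, ← restrict_Ioo_eq_restrict_Ioc]
    filter_upwards [ae_restrict_mem measurableSet_Ioo] with s hs
    rw [velocity, count_eq hτ hs.1.le (hs.2.trans_le h2)]
  refine ⟨_root_.intervalIntegrable_const.congr_ae h, ?_⟩
  rw [← intervalIntegral.integral_congr_ae_restrict h, intervalIntegral.integral_const,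
    smul_eq_mul, mul_comm]

lemma velocity_intervalIntegral_zero (V₀ : Ω → ℝ) (hτ : ∀ i, 0 ≤ τ i ω) (n : ℕ) {u : ℝ}
    (h1 : eventTime τ n ω ≤ u) (h2 : u ≤ eventTime τ (n + 1) ω) :
    IntervalIntegrable (fun s => velocity V₀ τ s ω) volume 0 u ∧
      position V₀ τ u ω = V₀ ω * (-1) ^ n * (u - 2 * ∑ i ∈ otherParity n, τ i ω) := by
  induction n generalizing u with
  | zero =>
    have h0 : eventTime τ 0 ω = 0 := by simp [eventTime]
    simpa [h0, position, otherParity] using velocity_intervalIntegral V₀ hτ h1 h2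
  | succ n ih =>
    obtain ⟨i1, e1⟩ := ih (eventTime_mono hτ n.le_succ) le_rfl
    obtain ⟨i2, e2⟩ := velocity_intervalIntegral V₀ hτ h1 h2
    refine ⟨i1.trans i2, ?_⟩
    -- A reversal exchanges time along and time against the current direction, so the new backward
    -- time is the total elapsed minus the old one.
    rw [position, ← intervalIntegral.integral_add_adjacent_intervals i1 i2, e2, ← position, e1,
      sum_otherParity_succ, ← eventTime]
    ring

/-- The position in terms of the total time spent moving against the current direction. -/
lemma position_eq (V₀ : Ω → ℝ) (hτ : ∀ i, 0 ≤ τ i ω) {n : ℕ} {t : ℝ}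
    (h1 : eventTime τ n ω ≤ t) (h2 : t < eventTime τ (n + 1) ω) :
    position V₀ τ t ω = V₀ ω * (-1) ^ n * (t - 2 * ∑ i ∈ otherParity n, τ i ω) :=
  (velocity_intervalIntegral_zero V₀ hτ n h1 h2.le).2

end Path

/-! ### Distribution of the position, conditioned on the number of events. -/

section Driver

variable {Ω : Type*} [MeasurableSpace Ω] {P : Measure Ω} {c lam : ℝ} {V₀ : Ω → ℝ} {τ : ℕ → Ω → ℝ}

lemma IsDriver.aemeasurable_waiting (h : IsDriver P c lam V₀ τ) (i : ℕ) : AEMeasurable (τ i) P :=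
  (h.law_waiting i).aemeasurable

lemma IsDriver.ae_waiting_nonneg (h : IsDriver P c lam V₀ τ) (hlam : 0 < lam) :
    ∀ᵐ ω ∂P, ∀ i, 0 ≤ τ i ω := by
  rw [ae_all_iff]
  intro i
  rw [(h.law_waiting i).ae_iff (p := fun x => 0 ≤ x) (measurableSet_setOfPred.1 measurableSet_Ici),
    expMeasure_eq_withDensity hlam, ae_withDensity_iff (by fun_prop)]
  refine Filter.Eventually.of_forall fun x hx => ?_
  by_contra hneg
  exact hx (by rw [poissonWeight_of_neg (not_le.1 hneg), mul_zero])

lemma IsDriver.hasLaw_sum (h : IsDriver P c lam V₀ τ) [IsProbabilityMeasure P] (hlam : 0 < lam)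
    (s : Finset ℕ) : HasLaw (fun ω => ∑ i ∈ s, τ i ω) (erlang lam s.card) P := by
  have := isProbabilityMeasure_expMeasure hlam
  induction s using Finset.induction_on with
  | empty => simpa [erlang] using hasLaw_dirac_of_ae_eq (Filter.EventuallyEq.refl _ _)
  | insert j s hj ih =>
    have : IsProbabilityMeasure (erlang lam s.card) := ih.isProbabilityMeasure_iff.1 inferInstance
    rw [Finset.card_insert_of_notMem hj, ← erlang_conv_expMeasure hlam]
    have hi := h.indep_waiting.indepFun_finsetSum_of_notMem₀ h.aemeasurable_waiting hj
    have hs : ∑ i ∈ s, τ i = fun ω => ∑ i ∈ s, τ i ω := by ext; simp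
    rw [hs] at hi
    convert hi.hasLaw_add ih (h.law_waiting j) using 1
    ext ω
    simp [Finset.sum_insert hj, add_comm]

lemma IsDriver.isProbabilityMeasure_erlang (h : IsDriver P c lam V₀ τ) [IsProbabilityMeasure P]
    (hlam : 0 < lam) (k : ℕ) : IsProbabilityMeasure (erlang lam k) := by
  simpa using (h.hasLaw_sum hlam (Finset.range k)).isProbabilityMeasure_iff.1 inferInstance

/-- The initial velocity, two sums of waiting times over disjoint index sets and a further waiting
time are independent. -/
lemma IsDriver.hasLaw_sums (h : IsDriver P c lam V₀ τ) [IsProbabilityMeasure P] (hlam : 0 < lam)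
    {s u : Finset ℕ} {j : ℕ} (hj : j ∉ u) (hd : Disjoint s (insert j u)) :
    HasLaw (fun ω => (V₀ ω, ∑ i ∈ s, τ i ω, ∑ i ∈ u, τ i ω, τ j ω))
      ((ENNReal.ofReal (1 / 2) • (Measure.dirac (-c) + Measure.dirac c)).prod
        ((erlang lam s.card).prod ((erlang lam u.card).prod (expMeasure lam)))) P := by
  have := isProbabilityMeasure_expMeasure hlam
  have := h.isProbabilityMeasure_erlang hlam
  have h1 : IndepFun (fun ω => ∑ i ∈ u, τ i ω) (τ j) P := by
    have hi := h.indep_waiting.indepFun_finsetSum_of_notMem₀ h.aemeasurable_waiting hj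
    have hs : ∑ i ∈ u, τ i = fun ω => ∑ i ∈ u, τ i ω := by ext; simp
    rwa [hs] at hi
  have h2 := h1.hasLaw_prod (h.hasLaw_sum hlam u) (h.law_waiting j)
  have h3 : IndepFun (fun ω => ∑ i ∈ s, τ i ω) (fun ω => (∑ i ∈ u, τ i ω, τ j ω)) P := by
    have hi := h.indep_waiting.indepFun_finset₀ s (insert j u) hd h.aemeasurable_waiting
    have hφ : Measurable fun a : s → ℝ => ∑ i, a i := by fun_prop
    have hψ : Measurable fun a : ↥(insert j u) → ℝ =>
        ((∑ i : u, a ⟨(i : ℕ), Finset.mem_insert_of_mem i.2⟩ : ℝ),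
          a ⟨j, Finset.mem_insert_self j u⟩) := by
      fun_prop
    convert hi.comp hφ hψ using 1
    · ext ω
      simpa using (Finset.sum_coe_sort s fun i => τ i ω).symm
    · ext ω
      · simpa using (Finset.sum_coe_sort u fun i => τ i ω).symm
      · simp
  have h4 := h3.hasLaw_prod (h.hasLaw_sum hlam s) h2
  have h5 : IndepFun V₀ (fun ω => (∑ i ∈ s, τ i ω, ∑ i ∈ u, τ i ω, τ j ω)) P :=
    h.indep.comp (φ := id) (ψ := fun a : ℕ → ℝ => (∑ i ∈ s, a i, ∑ i ∈ u, a i, a j))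
      measurable_id (by fun_prop)
  exact h5.hasLaw_prod h.law_velocity h4

/-- The event that exactly `n` events occur in `(0, t]`. -/
def countEvent (τ : ℕ → Ω → ℝ) (t : ℝ) (n : ℕ) : Set Ω :=
  {ω | eventTime τ n ω ≤ t ∧ t < eventTime τ (n + 1) ω}

lemma IsDriver.nullMeasurableSet_countEvent (h : IsDriver P c lam V₀ τ) (t : ℝ) (n : ℕ) :
    NullMeasurableSet (countEvent τ t n) P := by
  have hm : ∀ m, AEMeasurable (eventTime τ m) P := fun m => by
    have : eventTime τ m = ∑ i ∈ Finset.range m, τ i := by ext; simp [eventTime]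
    rw [this]
    exact Finset.aemeasurable_sum _ fun i _ => h.aemeasurable_waiting i
  exact (nullMeasurableSet_le (hm n) aemeasurable_const).inter
    (nullMeasurableSet_lt aemeasurable_const (hm (n + 1)))

/-- With `A` and `B` the sums over `u` and `s`, the event reads `A ≤ t - B < A + τ n`, and `V₀`,
`B`, `A`, `τ n` are independent. Integrating out `A` and `τ n` leaves a Poisson weight at `t - B`.
The splitting is kept general: `s = ∅` gives the Poisson law of the count, the parity splitting
gives the position. -/
lemma IsDriver.lintegral_countEvent (h : IsDriver P c lam V₀ τ) [IsProbabilityMeasure P]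
    (hlam : 0 < lam) (t : ℝ) {n : ℕ} {s u : Finset ℕ} (hn : n ∉ u) (hd : Disjoint s (insert n u))
    (hsum : ∀ w : ℕ → ℝ, ∑ i ∈ u, w i + ∑ i ∈ s, w i = ∑ i ∈ Finset.range n, w i)
    {g : ℝ → ℝ → ℝ≥0∞} (hg : Measurable (Function.uncurry g)) :
    ∫⁻ ω in countEvent τ t n, g (V₀ ω) (∑ i ∈ s, τ i ω) ∂P =
      ENNReal.ofReal (1 / 2) *
        (∫⁻ b, g (-c) b * poissonWeight lam u.card (t - b) ∂(erlang lam s.card) +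
          ∫⁻ b, g c b * poissonWeight lam u.card (t - b) ∂(erlang lam s.card)) := by
  have := isProbabilityMeasure_expMeasure hlam
  have := h.isProbabilityMeasure_erlang hlam
  rw [← lintegral_indicator₀ (h.nullMeasurableSet_countEvent t n)]
  set S : Set (ℝ × ℝ × ℝ × ℝ) :=
    {q | q.2.2.1 ≤ t - q.2.1 ∧ t - q.2.1 < q.2.2.1 + q.2.2.2} with hS
  have hSm : MeasurableSet S := by
    rw [hS, Set.ofPred_and]
    exact (measurableSet_le (by fun_prop) (by fun_prop)).inter
      (measurableSet_lt (by fun_prop) (by fun_prop))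
  set G : ℝ × ℝ × ℝ × ℝ → ℝ≥0∞ := fun q => g q.1 q.2.1 * S.indicator 1 q with hG
  have hgm : ∀ {α : Type} [MeasurableSpace α] {p q : α → ℝ}, Measurable p → Measurable q →
      Measurable fun x => g (p x) (q x) := fun hp hq => hg.comp (hp.prodMk hq)
  have hGm : Measurable G := (hgm (by fun_prop) (by fun_prop)).mul (measurable_one.indicator hSm)
  have hl := (h.hasLaw_sums hlam hn hd).lintegral_comp hGm.aemeasurable
  have heq : ∀ ω, (countEvent τ t n).indicator (fun ω => g (V₀ ω) (∑ i ∈ s, τ i ω)) ω =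
      G (V₀ ω, ∑ i ∈ s, τ i ω, ∑ i ∈ u, τ i ω, τ n ω) := by
    intro ω
    have : ω ∈ countEvent τ t n ↔ (V₀ ω, ∑ i ∈ s, τ i ω, ∑ i ∈ u, τ i ω, τ n ω) ∈ S := by
      simp only [countEvent, eventTime, Finset.sum_range_succ, ← hsum, hS, Set.mem_ofPred_eq,
        le_sub_iff_add_le, sub_lt_iff_lt_add]
      rw [add_right_comm]
    by_cases hω : ω ∈ countEvent τ t n
    · rw [Set.indicator_of_mem hω, hG]
      simp only []
      rw [Set.indicator_of_mem (this.1 hω)]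
      simp
    · rw [Set.indicator_of_notMem hω, hG]
      simp only []
      rw [Set.indicator_of_notMem (mt this.2 hω), mul_zero]
  have hin : ∀ v, ∫⁻ q, G (v, q) ∂((erlang lam s.card).prod ((erlang lam u.card).prod
      (expMeasure lam))) = ∫⁻ b, g v b * poissonWeight lam u.card (t - b) ∂(erlang lam s.card) := by
    intro v
    rw [lintegral_prod _ (by fun_prop)]
    refine lintegral_congr fun b => ?_
    have hS' : MeasurableSet {q : ℝ × ℝ | q.1 ≤ t - b ∧ t - b < q.1 + q.2} := by
      rw [Set.ofPred_and]
      exact (measurableSet_le (by fun_prop) (by fun_prop)).inter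
        (measurableSet_lt (by fun_prop) (by fun_prop))
    rw [← lintegral_indicator_expMeasure hlam,
      ← lintegral_prod _ (measurable_one.indicator hS').aemeasurable,
      ← lintegral_const_mul _ (measurable_one.indicator hS')]
    rfl
  simp_rw [heq]
  rw [hl, lintegral_prod _ hGm.aemeasurable]
  simp_rw [hin]
  have hFm : Measurable fun v => ∫⁻ b, g v b * poissonWeight lam u.card (t - b)
      ∂(erlang lam s.card) := by
    refine Measurable.lintegral_prod_right' (f := fun q : ℝ × ℝ => g q.1 q.2 *
      poissonWeight lam u.card (t - q.2)) ?_
    exact (hgm (by fun_prop) (by fun_prop)).mul (by fun_prop)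
  rw [lintegral_smul_measure, lintegral_add_measure, lintegral_dirac' _ hFm,
    lintegral_dirac' _ hFm, smul_eq_mul]

lemma IsDriver.measure_countEvent (h : IsDriver P c lam V₀ τ) [IsProbabilityMeasure P]
    (hlam : 0 < lam) (t : ℝ) (n : ℕ) : P (countEvent τ t n) = poissonWeight lam n t := by
  have := h.lintegral_countEvent hlam t (n := n) (s := ∅) (u := Finset.range n) (by simp)
    (by simp) (by simp) (g := fun _ _ => 1) (by fun_prop)
  simp only [lintegral_one, Measure.restrict_apply MeasurableSet.univ, Set.univ_inter, one_mul,
    Finset.card_range, Finset.card_empty, erlang,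
    lintegral_dirac, sub_zero] at this
  rw [this, ← two_mul, ← mul_assoc, ← ENNReal.ofReal_ofNat, ← ENNReal.ofReal_mul (by norm_num)]
  simp

/-- The count makes the events almost surely disjoint, and they cover almost everything because the
Poisson weights sum to one; no separate proof that the event times tend to infinity is needed. -/
lemma IsDriver.measure_eq_sum (h : IsDriver P c lam V₀ τ) [IsProbabilityMeasure P]
    (hlam : 0 < lam) {t : ℝ} (ht : 0 ≤ t) :
    P = Measure.sum fun n => P.restrict (countEvent τ t n) := by
  have hd : Pairwise (Function.onFun (AEDisjoint P) (countEvent τ t)) := by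
    intro m n hmn
    refine measure_mono_null (t := {ω | ¬ ∀ i, 0 ≤ τ i ω}) (fun ω hω hτ => hmn ?_)
      (ae_iff.1 (h.ae_waiting_nonneg hlam))
    rw [← count_eq hτ hω.1.1 hω.1.2, count_eq hτ hω.2.1 hω.2.2]
  have hm := h.nullMeasurableSet_countEvent t
  rw [← Measure.restrict_iUnion_ae hd hm]
  refine (Measure.restrict_eq_self_of_ae_mem ?_).symm
  change (⋃ n, countEvent τ t n) ∈ ae P
  rw [mem_ae_iff_prob_eq_one₀ (NullMeasurableSet.iUnion hm), measure_iUnion₀ hd hm]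
  simp_rw [h.measure_countEvent hlam]
  exact tsum_poissonWeight hlam ht

lemma IsDriver.ae_restrict_position_eq (h : IsDriver P c lam V₀ τ) [IsProbabilityMeasure P]
    (hlam : 0 < lam) (t : ℝ) (n : ℕ) :
    ∀ᵐ ω ∂P.restrict (countEvent τ t n),
      position V₀ τ t ω = V₀ ω * (-1) ^ n * (t - 2 * ∑ i ∈ otherParity n, τ i ω) := by
  filter_upwards [ae_restrict_mem₀ (h.nullMeasurableSet_countEvent t n),
    ae_restrict_of_ae (h.ae_waiting_nonneg hlam)] with ω hω hτ
  exact position_eq V₀ hτ hω.1 hω.2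

lemma IsDriver.aemeasurable_position (h : IsDriver P c lam V₀ τ) [IsProbabilityMeasure P]
    (hlam : 0 < lam) {t : ℝ} (ht : 0 ≤ t) : AEMeasurable (position V₀ τ t) P := by
  rw [h.measure_eq_sum hlam ht, aemeasurable_sum_measure_iff]
  intro n
  have hm : AEMeasurable (fun ω => V₀ ω * (-1) ^ n * (t - 2 * ∑ i ∈ otherParity n, τ i ω)) P :=
    (h.law_velocity.aemeasurable.mul_const _).mul
      (((h.hasLaw_sum hlam _).aemeasurable.const_mul 2).const_sub t)
  exact hm.restrict.congr (Filter.EventuallyEq.symm (h.ae_restrict_position_eq hlam t n))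

/-- The expectation of a function of the position, by number of events. -/
lemma IsDriver.lintegral_position (h : IsDriver P c lam V₀ τ) [IsProbabilityMeasure P]
    (hlam : 0 < lam) {t : ℝ} (ht : 0 ≤ t) {g : ℝ → ℝ≥0∞} (hg : Measurable g) :
    ∫⁻ ω, g (position V₀ τ t ω) ∂P = ∑' n : ℕ, ENNReal.ofReal (1 / 2) *
      (∫⁻ b, g (c * (t - 2 * b)) * poissonWeight lam (n / 2) (t - b) ∂(erlang lam ((n + 1) / 2)) +
        ∫⁻ b, g (-c * (t - 2 * b)) * poissonWeight lam (n / 2) (t - b)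
          ∂(erlang lam ((n + 1) / 2))) := by
  conv_lhs => rw [h.measure_eq_sum hlam ht]
  rw [lintegral_sum_measure]
  congr 1 with n
  have he := h.lintegral_countEvent hlam t (notMem_sameParity n) (disjoint_otherParity_insert n)
    (fun w => sum_parity w n) (g := fun v b => g (v * (-1) ^ n * (t - 2 * b)))
    (hg.comp (by fun_prop))
  rw [(card_parity n).1, (card_parity n).2] at he
  rw [lintegral_congr_ae ((h.ae_restrict_position_eq hlam t n).mono fun ω hω => by rw [hω]), he]
  -- An odd number of reversals merely exchanges the two equally likely initial velocities.
  rcases n.even_or_odd with hn | hn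
  · simp only [hn.neg_one_pow, mul_one]
    rw [add_comm]
  · simp only [hn.neg_one_pow, mul_neg, mul_one, neg_neg]

end Driver

/-! ### Power series of the modified Bessel functions. -/

section Bessel

lemma besselI_term_eq (n k : ℕ) (x : ℝ) :
    (x / 2) ^ (n + 2 * k) / (k.factorial * Real.Gamma (k + n + 1)) =
      (x / 2) ^ n * (((x / 2) ^ 2) ^ k / (k.factorial * (k + n).factorial)) := by
  rw [← Nat.cast_add, Real.Gamma_nat_eq_factorial, pow_add, pow_mul, mul_div_assoc]

lemma summable_pow_div_factorial_mul (n : ℕ) {y : ℝ} (hy : 0 ≤ y) :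
    Summable fun k : ℕ => y ^ k / ((k.factorial : ℝ) * ((k + n).factorial : ℝ)) := by
  refine Summable.of_nonneg_of_le (fun k => by positivity) (fun k => ?_)
    (Real.summable_pow_div_factorial y)
  gcongr
  exact le_mul_of_one_le_right (by positivity) (by exact_mod_cast (k + n).factorial_pos)

lemma hasSum_besselI (n : ℕ) (x : ℝ) :
    HasSum (fun k : ℕ => (x / 2) ^ (n + 2 * k) / (k.factorial * Real.Gamma (k + n + 1)))
      (besselI n x) := by
  refine Summable.hasSum ?_
  simp_rw [besselI_term_eq]
  exact (summable_pow_div_factorial_mul n (sq_nonneg _)).mul_left _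

lemma besselI_two_mul (n : ℕ) (s : ℝ) :
    besselI n (2 * s) =
      s ^ n * ∑' k : ℕ, (s ^ 2) ^ k / ((k.factorial : ℝ) * ((k + n).factorial : ℝ)) := by
  simp_rw [besselI, besselI_term_eq, tsum_mul_left, mul_div_cancel_left₀ s two_ne_zero]

lemma besselI_nonneg (n : ℕ) {x : ℝ} (hx : 0 ≤ x) : 0 ≤ besselI n x := by
  refine tsum_nonneg fun k => ?_
  rw [besselI_term_eq]
  positivity

@[fun_prop]
lemma measurable_besselI (n : ℕ) : Measurable (besselI n) := by
  refine measurable_of_tendsto_metrizable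
    (f := fun N x => ∑ k ∈ Finset.range N,
      (x / 2) ^ (n + 2 * k) / (k.factorial * Real.Gamma (k + n + 1))) (fun N => by fun_prop) ?_
  exact tendsto_pi_nhds.2 fun x => (hasSum_besselI n x).tendsto_sum_nat

end Bessel

/-! ### The Poisson series behind the density. -/

section Density

variable {c lam : ℝ}

@[fun_prop]
lemma measurable_muCut (c lam t : ℝ) : Measurable fun x => muCut c lam x t := by
  have h : Measurable fun x => mu c lam x t := by unfold mu; fun_prop
  refine h.indicator ?_
  exact measurableSet_lt (by fun_prop) (by fun_prop)

lemma muCut_nonneg (hc : 0 < c) (hlam : 0 < lam) (x t : ℝ) : 0 ≤ muCut c lam x t := by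
  refine Set.indicator_nonneg (fun y hy => ?_) x
  have ht : 0 < t := pos_of_mul_pos_right ((abs_nonneg y).trans_lt hy) hc.le
  have h0 := besselI_nonneg 0 (x := lam / c * √(c ^ 2 * t ^ 2 - y ^ 2)) (by positivity)
  have h1 := besselI_nonneg 1 (x := lam / c * √(c ^ 2 * t ^ 2 - y ^ 2)) (by positivity)
  unfold mu
  positivity

lemma muCut_of_le {x t : ℝ} (h : c * t ≤ |x|) : muCut c lam x t = 0 :=
  Set.indicator_of_notMem (by simpa using h) _

/-- At `x = c (t - 2 b)` one has `c² t² - x² = 4 c² b (t - b)`, so the Bessel arguments are `2 lam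
√(b (t - b))`. The root in front of the `I_1` series cancels the denominator, which is nonzero for
`0 < b < t`. The factor `2 c` is the Jacobian `|dx/db|`. -/
lemma two_mul_mul_mu (hc : 0 < c) (hlam : 0 < lam) {t b : ℝ} (hb : 0 < b) (hbt : b < t) :
    2 * c * mu c lam (c * (t - 2 * b)) t =
      lam * exp (-lam * t) *
        (∑' k : ℕ, (lam ^ 2 * (b * (t - b))) ^ k / ((k.factorial : ℝ) * (k.factorial : ℝ)) +
          lam * t / 2 * ∑' k : ℕ,
            (lam ^ 2 * (b * (t - b))) ^ k / ((k.factorial : ℝ) * ((k + 1).factorial : ℝ))) := by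
  have hp : 0 < b * (t - b) := mul_pos hb (sub_pos.2 hbt)
  have hr : √(c ^ 2 * t ^ 2 - (c * (t - 2 * b)) ^ 2) = 2 * c * √(b * (t - b)) := by
    rw [show c ^ 2 * t ^ 2 - (c * (t - 2 * b)) ^ 2 = (2 * c) ^ 2 * (b * (t - b)) by ring,
      Real.sqrt_mul (by positivity), Real.sqrt_sq (by positivity)]
  have hz : lam / c * (2 * c * √(b * (t - b))) = 2 * (lam * √(b * (t - b))) := by
    field_simp
  have hs : (lam * √(b * (t - b))) ^ 2 = lam ^ 2 * (b * (t - b)) := by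
    rw [mul_pow, Real.sq_sqrt hp.le]
  rw [mu, hr, hz, besselI_two_mul, besselI_two_mul, hs]
  have := Real.sqrt_pos.2 hp
  simp only [add_zero]
  field_simp

/-- The equal-index products yield the `I_0` series. The two mixed products differ by a factor `t -
b` against `b`; these add up to `t` and yield the `I_1` series. The points `b = 0` and `b = t` are
excluded because the weights need not vanish there, whereas `muCut` does. -/
lemma tsum_poissonWeight_mul (hc : 0 < c) (hlam : 0 < lam) {t b : ℝ} (hb0 : b ≠ 0)
    (hbt : b ≠ t) :
    ∑' k, ENNReal.ofReal (1 / 2) * ENNReal.ofReal lam *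
      (2 * (poissonWeight lam k b * poissonWeight lam k (t - b)) +
        poissonWeight lam k b * poissonWeight lam (k + 1) (t - b) +
          poissonWeight lam (k + 1) b * poissonWeight lam k (t - b)) =
      ENNReal.ofReal (2 * c) * ENNReal.ofReal (muCut c lam (c * (t - 2 * b)) t) := by
  by_cases h : 0 < b ∧ b < t
  · obtain ⟨hb, ht⟩ := h
    have hp : 0 ≤ lam ^ 2 * (b * (t - b)) := by
      have := sub_pos.2 ht
      positivity
    have hmem : |c * (t - 2 * b)| < c * t := by
      rw [abs_mul, abs_of_pos hc]
      gcongr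
      rw [abs_lt]
      constructor <;> linarith
    have hs := ((summable_pow_div_factorial_mul 0 hp).hasSum.add
      ((summable_pow_div_factorial_mul 1 hp).hasSum.mul_left (lam * t / 2))).mul_left
        (lam * exp (-lam * t))
    simp only [add_zero] at hs
    rw [← two_mul_mul_mu hc hlam hb ht] at hs
    rw [muCut, Set.indicator_of_mem (by exact hmem),
      ← ENNReal.ofReal_mul (p := 2 * c) (by positivity),
      ← hs.tsum_eq, ENNReal.ofReal_tsum_of_nonneg _ hs.summable]
    · congr 1 with k
      have hb' := sub_pos.2 ht
      rw [← ENNReal.ofReal_ofNat 2]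
      simp only [poissonWeight_of_nonneg hb.le, poissonWeight_of_nonneg hb'.le]
      rw [← ENNReal.ofReal_mul (by positivity), ← ENNReal.ofReal_mul (by positivity),
        ← ENNReal.ofReal_mul (by positivity), ← ENNReal.ofReal_mul (by positivity),
        ← ENNReal.ofReal_mul (by positivity), ← ENNReal.ofReal_add (by positivity) (by positivity),
        ← ENNReal.ofReal_add (by positivity) (by positivity),
        ← ENNReal.ofReal_mul (by positivity)]
      congr 1
      have he : exp (-lam * t) = exp (-lam * b) * exp (-lam * (t - b)) := by
        rw [← exp_add]; ring_nf
      rw [he, Nat.factorial_succ]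
      obtain ⟨d, rfl⟩ : ∃ d, t = b + d := ⟨t - b, by ring⟩
      rw [add_sub_cancel_left]
      push_cast
      field_simp
      ring
    · intro k
      have := hb.trans ht
      positivity
  · have hz : b < 0 ∨ t - b < 0 := by
      rcases hb0.lt_or_gt with hb | hb
      · exact Or.inl hb
      · exact Or.inr (sub_neg.2 (hbt.lt_or_gt.resolve_left fun h' => h ⟨hb, h'⟩))
    have hle : c * t ≤ |c * (t - 2 * b)| := by
      rw [abs_mul, abs_of_pos hc]
      gcongr
      rcases hz with hz | hz
      · exact le_trans (by linarith) (le_abs_self _)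
      · exact le_trans (by linarith) (neg_le_abs _)
    rw [muCut_of_le hle]
    rcases hz with hz | hz <;> simp [poissonWeight_of_neg hz]

lemma lintegral_comp_sub_two_mul (hc : 0 < c) {f : ℝ → ℝ≥0∞} (hf : Measurable f) (t : ℝ) :
    ENNReal.ofReal (2 * c) * ∫⁻ b, f (c * (t - 2 * b)) = ∫⁻ x, f x := by
  have h : ∀ b, f (c * (t - 2 * b)) = f (c * t - 2 * c * b) := fun b => by congr 1; ring
  simp_rw [h]
  rw [← lintegral_sub_left_eq_self f (c * t)]
  conv_rhs => rw [← Real.smul_map_volume_mul_left (a := 2 * c) (by positivity)]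
  rw [lintegral_smul_measure, lintegral_map (by fun_prop) (by fun_prop),
    abs_of_pos (by positivity), smul_eq_mul]

lemma lintegral_erlang_succ (k : ℕ) {f : ℝ → ℝ≥0∞} (hf : Measurable f) :
    ∫⁻ b, f b ∂(erlang lam (k + 1)) =
      ∫⁻ b, ENNReal.ofReal lam * (poissonWeight lam k b * f b) := by
  rw [erlang, lintegral_withDensity_eq_lintegral_mul _ (by fun_prop) hf]
  simp [mul_assoc]

/-- The contributions of `2 k + 1` and of `2 k + 2` events. -/
lemma lintegral_erlang_add (t : ℝ) (k : ℕ) {g : ℝ → ℝ≥0∞} (hg : Measurable g) :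
    (∫⁻ b, g (c * (t - 2 * b)) * poissonWeight lam k (t - b) ∂(erlang lam (k + 1)) +
        ∫⁻ b, g (-c * (t - 2 * b)) * poissonWeight lam k (t - b) ∂(erlang lam (k + 1))) +
      (∫⁻ b, g (c * (t - 2 * b)) * poissonWeight lam (k + 1) (t - b) ∂(erlang lam (k + 1)) +
        ∫⁻ b, g (-c * (t - 2 * b)) * poissonWeight lam (k + 1) (t - b) ∂(erlang lam (k + 1))) =
    ∫⁻ b, ENNReal.ofReal lam *
      (2 * (poissonWeight lam k b * poissonWeight lam k (t - b)) +
        poissonWeight lam k b * poissonWeight lam (k + 1) (t - b) +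
          poissonWeight lam (k + 1) b * poissonWeight lam k (t - b)) * g (c * (t - 2 * b)) := by
  have hneg : ∀ j, ∫⁻ b, g (-c * (t - 2 * b)) * poissonWeight lam j (t - b)
      ∂(erlang lam (k + 1)) = ∫⁻ b, ENNReal.ofReal lam * (poissonWeight lam k (t - b) *
        (g (c * (t - 2 * b)) * poissonWeight lam j b)) := by
    intro j
    -- The reflection `b ↦ t - b` turns `-c` into `c` and swaps the two Poisson weights.
    rw [lintegral_erlang_succ _ (by fun_prop), ← lintegral_sub_left_eq_self _ t]
    refine lintegral_congr fun b => ?_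
    rw [sub_sub_cancel, show -c * (t - 2 * (t - b)) = c * (t - 2 * b) by ring]
  rw [hneg, hneg, lintegral_erlang_succ _ (by fun_prop), lintegral_erlang_succ _ (by fun_prop),
    ← lintegral_add_left (by fun_prop), ← lintegral_add_left (by fun_prop),
    ← lintegral_add_left (by fun_prop)]
  refine lintegral_congr fun b => ?_
  ring

end Density

/-- The law of the telegraph process. -/
theorem IsDriver.hasLaw_position {Ω : Type*} [MeasurableSpace Ω] {P : Measure Ω}
    [IsProbabilityMeasure P] {c lam : ℝ} (hc : 0 < c) (hlam : 0 < lam) {V₀ : Ω → ℝ}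
    {τ : ℕ → Ω → ℝ} (h : IsDriver P c lam V₀ τ) {t : ℝ} (ht : 0 ≤ t) :
    HasLaw (position V₀ τ t) (law c lam t) P := by
  have hX := h.aemeasurable_position hlam ht
  refine ⟨hX, Measure.ext_of_lintegral _ fun g hg => ?_⟩
  -- Splits off `n = 0`, which gives the atoms, and pairs `n = 2 k + 1` with `n = 2 k + 2`.
  rw [lintegral_map' hg.aemeasurable hX, h.lintegral_position hlam ht hg,
    tsum_eq_zero_add' ENNReal.summable, ← tsum_even_add_odd ENNReal.summable ENNReal.summable,
    ← ENNReal.tsum_add, law, lintegral_add_measure, lintegral_smul_measure,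
    lintegral_add_measure, lintegral_dirac' _ hg, lintegral_dirac' _ hg]
  congr 1
  · simp only [zero_add, show (1 : ℕ) / 2 = 0 from rfl, erlang, neg_mul]
    rw [lintegral_dirac' _ (by fun_prop), lintegral_dirac' _ (by fun_prop)]
    simp only [mul_zero, sub_zero]
    have hw : ENNReal.ofReal (exp (-(lam * t)) / 2) =
        ENNReal.ofReal (1 / 2) * poissonWeight lam 0 t := by
      rw [poissonWeight_of_nonneg ht, ← ENNReal.ofReal_mul (by norm_num)]
      congr 1
      simp
      ring
    rw [hw, smul_eq_mul]
    ring
  · have hk : ∀ k : ℕ, (2 * k + 1) / 2 = k ∧ (2 * k + 1 + 1) / 2 = k + 1 ∧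
      (2 * k + 1 + 1 + 1) / 2 = k + 1 := fun k => by omega
    conv_lhs =>
      enter [1, k]
      rw [(hk k).1, (hk k).2.1, (hk k).2.2, ← mul_add, lintegral_erlang_add t k hg,
        ← lintegral_const_mul' _ _ ENNReal.ofReal_ne_top]
    rw [← lintegral_tsum (fun k => by fun_prop),
      lintegral_withDensity_eq_lintegral_mul _ (by fun_prop) hg,
      ← lintegral_comp_sub_two_mul hc
        (f := (fun x => ENNReal.ofReal (muCut c lam x t)) * g) (by fun_prop) t,
      ← lintegral_const_mul' _ _ ENNReal.ofReal_ne_top]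
    refine lintegral_congr_ae ?_
    filter_upwards [Measure.ae_ne volume 0, Measure.ae_ne volume t] with b hb0 hbt
    rw [Pi.mul_apply, ← mul_assoc, ← tsum_poissonWeight_mul hc hlam hb0 hbt,
      ← ENNReal.tsum_mul_right]
    simp_rw [mul_assoc]

/-! ### Distribution functions and decomposition into periods. -/

section CDF

variable (ν : Measure ℝ) [IsProbabilityMeasure ν]

lemma real_Ioc_eq_cdf_sub {a b : ℝ} (hab : a ≤ b) : ν.real (Set.Ioc a b) = cdf ν b - cdf ν a := by
  conv_lhs => rw [← measure_cdf ν]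
  rw [measureReal_def, StieltjesFunction.measure_Ioc,
    ENNReal.toReal_ofReal (sub_nonneg.2 (monotone_cdf ν hab))]

lemma real_Icc_eq_cdf_sub {a b : ℝ} (hab : a ≤ b) :
    ν.real (Set.Icc a b) = cdf ν b - Function.leftLim (cdf ν) a := by
  conv_lhs => rw [← measure_cdf ν]
  rw [measureReal_def, StieltjesFunction.measure_Icc,
    ENNReal.toReal_ofReal (sub_nonneg.2 ((monotone_cdf ν).leftLim_le hab))]

lemma leftLim_cdf_eq {a : ℝ} (ha : ν {a} = 0) : Function.leftLim (cdf ν) a = cdf ν a := by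
  rw [← measure_cdf ν, StieltjesFunction.measure_singleton, ENNReal.ofReal_eq_zero] at ha
  exact le_antisymm ((monotone_cdf ν).leftLim_le le_rfl) (sub_nonpos.1 ha)

lemma Ioc_two_pi_eq (θ : ℝ) (k : ℤ) :
    Set.Ioc (θ + 2 * k * π) (θ + 2 * k * π + 2 * π) =
      Set.Ioc (θ + k • (2 * π)) (θ + (k + 1) • (2 * π)) := by
  simp only [zsmul_eq_mul]
  push_cast
  ring_nf

lemma iUnion_Ioc_two_pi (θ : ℝ) :
    ⋃ k : ℤ, Set.Ioc (θ + 2 * k * π) (θ + 2 * k * π + 2 * π) = Set.univ := by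
  simp_rw [Ioc_two_pi_eq]
  exact iUnion_Ioc_add_zsmul two_pi_pos θ

lemma pairwise_disjoint_Ioc_two_pi (θ : ℝ) :
    Pairwise (Function.onFun Disjoint
      fun k : ℤ => Set.Ioc (θ + 2 * k * π) (θ + 2 * k * π + 2 * π)) := by
  simp_rw [Ioc_two_pi_eq]
  exact Set.pairwise_disjoint_Ioc_add_zsmul θ (2 * π)

lemma hasSum_real_inter_Ioc {S : Set ℝ} (hS : MeasurableSet S) (θ : ℝ) :
    HasSum (fun k : ℤ => ν.real (S ∩ Set.Ioc (θ + 2 * k * π) (θ + 2 * k * π + 2 * π)))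
      (ν.real S) := by
  have h : ν S = ∑' k : ℤ, ν (S ∩ Set.Ioc (θ + 2 * k * π) (θ + 2 * k * π + 2 * π)) := by
    rw [← measure_iUnion _ fun k => hS.inter measurableSet_Ioc, ← Set.inter_iUnion,
      iUnion_Ioc_two_pi, Set.inter_univ]
    exact fun i j hij => (pairwise_disjoint_Ioc_two_pi θ hij).mono
      Set.inter_subset_right Set.inter_subset_right
  have hs := ENNReal.hasSum_toReal (h ▸ measure_ne_top ν S)
  rwa [← ENNReal.tsum_toReal_eq fun k => measure_ne_top _ _, ← h] at hs

end CDF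

/-! ### Sublevel sets of cosine and sine in one period. -/

section Trigonometric

lemma cos_le_iff_arccos_le {v x : ℝ} (hv : v ∈ Set.Icc 0 π) (hx : x ∈ Set.Icc (-1 : ℝ) 1) :
    cos v ≤ x ↔ arccos x ≤ v := by
  conv_lhs => rw [← cos_arccos hx.1 hx.2]
  exact strictAntiOn_cos.le_iff_ge hv ⟨arccos_nonneg x, arccos_le_pi x⟩

/-- One closed arc per period; its closed left end is the source of the left limits in the series.
For `x = 1` that end would be `2 k π`, which the window omits. -/
lemma setOf_cos_le_inter_Ioc {x : ℝ} (hx : x ∈ Set.Ico (-1 : ℝ) 1) (k : ℤ) :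
    {u : ℝ | cos u ≤ x} ∩ Set.Ioc (0 + 2 * k * π) (0 + 2 * k * π + 2 * π) =
      Set.Icc (arccos x + 2 * k * π) ((2 * k + 2) * π - arccos x) := by
  have hx' := Set.Ico_subset_Icc_self hx
  have h0 : 0 < arccos x := arccos_pos.2 hx.2
  have h1 := arccos_le_pi x
  ext u
  obtain ⟨v, rfl⟩ : ∃ v, u = v + k * (2 * π) := ⟨u - k * (2 * π), by ring⟩
  simp only [Set.mem_inter_iff, Set.mem_ofPred_eq, cos_add_int_mul_two_pi, Set.mem_Ioc, Set.mem_Icc]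
  constructor
  · rintro ⟨hc, hl, hr⟩
    rcases le_total v π with hv | hv
    · have := (cos_le_iff_arccos_le ⟨by linarith, hv⟩ hx').1 hc
      constructor <;> linarith
    · rw [← cos_two_pi_sub, cos_le_iff_arccos_le ⟨by linarith, by linarith⟩ hx'] at hc
      constructor <;> linarith
  · rintro ⟨hl, hr⟩
    refine ⟨?_, by linarith, by linarith⟩
    rcases le_total v π with hv | hv
    · exact (cos_le_iff_arccos_le ⟨by linarith, hv⟩ hx').2 (by linarith)
    · rw [← cos_two_pi_sub, cos_le_iff_arccos_le ⟨by linarith, by linarith⟩ hx']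
      linarith

/-- Windows starting at `-π / 2` leave one arc on each side of the maximum of `sin`. Only the second
arc is closed on the left, so only its left end requires a left limit. -/
lemma setOf_sin_le_inter_Ioc {x : ℝ} (hx : x ∈ Set.Ico (-1 : ℝ) 1) (k : ℤ) :
    {u : ℝ | sin u ≤ x} ∩ Set.Ioc (-(π / 2) + 2 * k * π) (-(π / 2) + 2 * k * π + 2 * π) =
      Set.Ioc ((2 * k - 1 / 2) * π) (arcsin x + 2 * k * π) ∪
        Set.Icc ((2 * k + 1) * π - arcsin x) ((2 * k + 3 / 2) * π) := by
  have hx' := Set.Ico_subset_Icc_self hx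
  have h0 : arcsin x < π / 2 := arcsin_lt_pi_div_two.2 hx.2
  have h1 := neg_pi_div_two_le_arcsin x
  ext u
  obtain ⟨v, rfl⟩ : ∃ v, u = v + k * (2 * π) := ⟨u - k * (2 * π), by ring⟩
  simp only [Set.mem_inter_iff, Set.mem_ofPred_eq, sin_add_int_mul_two_pi, Set.mem_Ioc,
    Set.mem_Icc, Set.mem_union]
  have hpi := pi_pos
  constructor
  · rintro ⟨hc, hl, hr⟩
    rcases le_total v (π / 2) with hv | hv
    · have := (le_arcsin_iff_sin_le ⟨by linarith, hv⟩ hx').2 hc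
      left
      constructor <;> linarith
    · rw [← sin_pi_sub, ← le_arcsin_iff_sin_le ⟨by linarith, by linarith⟩ hx'] at hc
      right
      constructor <;> linarith
  · rintro (⟨hl, hr⟩ | ⟨hl, hr⟩)
    · refine ⟨?_, by linarith, by linarith⟩
      exact (le_arcsin_iff_sin_le ⟨by linarith, by linarith⟩ hx').1 (by linarith)
    · refine ⟨?_, by linarith, by linarith⟩
      rw [← sin_pi_sub, ← le_arcsin_iff_sin_le ⟨by linarith, by linarith⟩ hx']
      linarith

variable (ν : Measure ℝ) [IsProbabilityMeasure ν]

lemma hasSum_cdf_cos_left {x : ℝ} (hx : x ∈ Set.Ico (-1 : ℝ) 1) :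
    HasSum (fun k : ℤ => cdf ν ((2 * k + 2) * π - arccos x) -
      Function.leftLim (cdf ν) (arccos x + 2 * k * π)) (ν.real {u | cos u ≤ x}) := by
  have h := hasSum_real_inter_Ioc ν (S := {u | cos u ≤ x})
    (measurableSet_le (by fun_prop) (by fun_prop)) 0
  have h1 := arccos_le_pi x
  convert h using 2 with k
  rw [setOf_cos_le_inter_Ioc hx, real_Icc_eq_cdf_sub _ (by linarith)]

/-- Without atoms at the left ends the left limits are values. At `x = 1` each term is the mass of a
whole half-open period, so atoms do no harm. -/
lemma hasSum_cdf_cos {x : ℝ} (hx : x ∈ Set.Icc (-1 : ℝ) 1)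
    (h : (∀ k : ℤ, ν {arccos x + 2 * k * π} = 0) ∨ x = 1) :
    HasSum (fun k : ℤ => cdf ν ((2 * k + 2) * π - arccos x) - cdf ν (arccos x + 2 * k * π))
      (ν.real {u | cos u ≤ x}) := by
  rcases eq_or_ne x 1 with rfl | hx1
  · have hu : {u : ℝ | cos u ≤ 1} = Set.univ := Set.eq_univ_of_forall cos_le_one
    rw [hu]
    convert hasSum_real_inter_Ioc ν MeasurableSet.univ 0 using 2 with k
    rw [Set.univ_inter, real_Ioc_eq_cdf_sub _ (by linarith [pi_pos]), arccos_one]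
    ring_nf
  · convert hasSum_cdf_cos_left ν ⟨hx.1, lt_of_le_of_ne hx.2 hx1⟩ using 3 with k
    rw [leftLim_cdf_eq _ (h.resolve_right hx1 k)]

lemma hasSum_cdf_sin_left {x : ℝ} (hx : x ∈ Set.Ico (-1 : ℝ) 1) :
    HasSum (fun k : ℤ => cdf ν (arcsin x + 2 * k * π) - cdf ν ((2 * k - 1 / 2) * π) +
      cdf ν ((2 * k + 3 / 2) * π) - Function.leftLim (cdf ν) ((2 * k + 1) * π - arcsin x))
      (ν.real {u | sin u ≤ x}) := by
  have h := hasSum_real_inter_Ioc ν (S := {u | sin u ≤ x})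
    (measurableSet_le (by fun_prop) (by fun_prop)) (-(π / 2))
  have h0 : arcsin x < π / 2 := arcsin_lt_pi_div_two.2 hx.2
  have h1 := neg_pi_div_two_le_arcsin x
  convert h using 2 with k
  rw [setOf_sin_le_inter_Ioc hx, measureReal_union _ measurableSet_Icc,
    real_Ioc_eq_cdf_sub _ (by linarith), real_Icc_eq_cdf_sub _ (by linarith)]
  · ring
  · refine Set.disjoint_left.2 fun u hu hu' => ?_
    linarith [hu.2, hu'.1]

lemma hasSum_cdf_sin {x : ℝ} (hx : x ∈ Set.Icc (-1 : ℝ) 1)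
    (h : (∀ k : ℤ, ν {(2 * k + 1) * π - arcsin x} = 0) ∨ x = 1) :
    HasSum (fun k : ℤ => cdf ν (arcsin x + 2 * k * π) - cdf ν ((2 * k - 1 / 2) * π) +
      cdf ν ((2 * k + 3 / 2) * π) - cdf ν ((2 * k + 1) * π - arcsin x))
      (ν.real {u | sin u ≤ x}) := by
  rcases eq_or_ne x 1 with rfl | hx1
  · have hu : {u : ℝ | sin u ≤ 1} = Set.univ := Set.eq_univ_of_forall sin_le_one
    rw [hu]
    convert hasSum_real_inter_Ioc ν MeasurableSet.univ (-(π / 2)) using 2 with k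
    rw [Set.univ_inter, real_Ioc_eq_cdf_sub _ (by linarith [pi_pos]), arcsin_one]
    ring_nf
  · convert hasSum_cdf_sin_left ν ⟨hx.1, lt_of_le_of_ne hx.2 hx1⟩ using 3 with k
    rw [leftLim_cdf_eq _ (h.resolve_right hx1 k)]

end Trigonometric

lemma law_singleton {c lam t y : ℝ} (h1 : y ≠ -(c * t)) (h2 : y ≠ c * t) :
    law c lam t {y} = 0 := by
  have : volume.withDensity (fun x => ENNReal.ofReal (muCut c lam x t)) {y} = 0 :=
    withDensity_absolutelyContinuous _ _ (measure_singleton y)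
  simp [law, this, h1.symm, h2.symm]

/-! ### Transport of densities by the inverse branches of cosine and sine. -/

section ChangeOfVariables

lemma image_arccos_Ioo : arccos '' Set.Ioo (-1) 1 = Set.Ioo 0 π := by
  ext v
  constructor
  · rintro ⟨x, hx, rfl⟩
    exact ⟨arccos_pos.2 hx.2, (arccos_le_pi x).lt_of_ne fun h => hx.1.not_ge (arccos_eq_pi.1 h)⟩
  · intro hv
    refine ⟨cos v, ⟨?_, ?_⟩, arccos_cos hv.1.le hv.2.le⟩
    · rw [← cos_pi]
      exact cos_lt_cos_of_nonneg_of_le_pi hv.1.le le_rfl hv.2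
    · rw [← cos_zero]
      exact cos_lt_cos_of_nonneg_of_le_pi le_rfl hv.2.le hv.1

/-- Change of variables along `x ↦ a + s arccos x`, where `s = ± 1`. -/
lemma lintegral_image_arccos (a : ℝ) {s : ℝ} (hs : |s| = 1) (h : ℝ → ℝ≥0∞) :
    ∫⁻ u in (fun x => a + s * arccos x) '' Set.Ioo (-1) 1, h u =
      ∫⁻ x in Set.Ioo (-1) 1, ENNReal.ofReal (1 / √(1 - x ^ 2)) * h (a + s * arccos x) := by
  have hs0 : s ≠ 0 := by rintro rfl; simp at hs
  rw [lintegral_image_eq_lintegral_abs_deriv_mul measurableSet_Ioo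
    (f' := fun x => s * -(1 / √(1 - x ^ 2)))]
  · refine lintegral_congr fun x => ?_
    rw [abs_mul, hs, one_mul, abs_neg, abs_of_nonneg (by positivity)]
  · intro x hx
    exact (((hasDerivAt_arccos hx.1.ne' hx.2.ne).const_mul s).const_add a).hasDerivWithinAt
  · intro x hx y hy hxy
    have : arccos x = arccos y := mul_left_cancel₀ hs0 (add_left_cancel hxy)
    exact arccos_injOn (Set.Ioo_subset_Icc_self hx) (Set.Ioo_subset_Icc_self hy) this

/-- The period is cut at its midpoint: `cos` decreases on the first half and increases on the
second, and each half is the image of `(-1, 1)` under one inverse branch, up to null endpoints. -/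
lemma setLIntegral_Ioc_two_pi (k : ℤ) (h : ℝ → ℝ≥0∞) :
    ∫⁻ u in Set.Ioc (0 + 2 * k * π) (0 + 2 * k * π + 2 * π), h u =
      (∫⁻ x in Set.Ioo (-1) 1,
        ENNReal.ofReal (1 / √(1 - x ^ 2)) * h ((2 * k + 2) * π - arccos x)) +
      ∫⁻ x in Set.Ioo (-1) 1, ENNReal.ofReal (1 / √(1 - x ^ 2)) * h (arccos x + 2 * k * π) := by
  have hp := pi_pos
  have e1 : (fun x => 2 * k * π + 1 * arccos x) '' Set.Ioo (-1) 1 =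
      Set.Ioo (2 * k * π) (2 * k * π + π) := by
    simp_rw [one_mul]
    rw [← Set.image_image (fun v => 2 * k * π + v) arccos, image_arccos_Ioo,
      Set.image_const_add_Ioo, add_zero]
  have e2 : (fun x => (2 * k + 2) * π + -1 * arccos x) '' Set.Ioo (-1) 1 =
      Set.Ioo (2 * k * π + π) (2 * k * π + 2 * π) := by
    simp_rw [neg_one_mul, ← sub_eq_add_neg]
    rw [← Set.image_image (fun v => (2 * k + 2) * π - v) arccos, image_arccos_Ioo,
      Set.image_const_sub_Ioo]
    ring_nf
  have h1 := lintegral_image_arccos (2 * k * π) (s := 1) (by simp) h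
  have h2 := lintegral_image_arccos ((2 * k + 2) * π) (s := -1) (by simp) h
  rw [e1, restrict_Ioo_eq_restrict_Ioc] at h1
  rw [e2, restrict_Ioo_eq_restrict_Ioc] at h2
  rw [zero_add, ← Set.Ioc_union_Ioc_eq_Ioc (b := 2 * k * π + π) (by linarith) (by linarith),
    lintegral_union measurableSet_Ioc (Set.Ioc_disjoint_Ioc_of_le le_rfl), h1, h2, add_comm]
  simp_rw [neg_one_mul, ← sub_eq_add_neg, one_mul, add_comm (2 * (k : ℝ) * π)]

lemma lintegral_cos_mul {g m : ℝ → ℝ≥0∞} (hg : Measurable g) (hm : Measurable m) :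
    ∫⁻ u, g (cos u) * m u =
      ∫⁻ x in Set.Ioo (-1) 1, g x * (ENNReal.ofReal (1 / √(1 - x ^ 2)) *
        ∑' k : ℤ, (m ((2 * k + 2) * π - arccos x) + m (arccos x + 2 * k * π))) := by
  rw [← setLIntegral_univ, ← iUnion_Ioc_two_pi 0,
    lintegral_iUnion (fun _ => measurableSet_Ioc) (pairwise_disjoint_Ioc_two_pi 0)]
  simp_rw [setLIntegral_Ioc_two_pi, ← ENNReal.tsum_mul_left]
  rw [lintegral_tsum fun k => by fun_prop]
  congr 1 with k
  rw [← lintegral_add_left (by fun_prop)]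
  refine setLIntegral_congr_fun measurableSet_Ioo fun x hx => ?_
  have hc : cos (arccos x) = x := cos_arccos hx.1.le hx.2.le
  have c1 : cos ((2 * k + 2) * π - arccos x) = x := by
    rw [show (2 * k + 2) * π - arccos x = ((k + 1 : ℤ) : ℝ) * (2 * π) - arccos x by
      push_cast; ring, cos_int_mul_two_pi_sub, hc]
  have c2 : cos (arccos x + 2 * k * π) = x := by
    rw [show arccos x + 2 * k * π = arccos x + k * (2 * π) by ring, cos_add_int_mul_two_pi, hc]
  simp only [c1, c2]
  ring

lemma lintegral_sin_mul {g m : ℝ → ℝ≥0∞} (hg : Measurable g) (hm : Measurable m) :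
    ∫⁻ u, g (sin u) * m u =
      ∫⁻ x in Set.Ioo (-1) 1, g x * (ENNReal.ofReal (1 / √(1 - x ^ 2)) *
        ∑' k : ℤ, (m (arcsin x + 2 * k * π) + m ((2 * k + 1) * π - arcsin x))) := by
  rw [← lintegral_sub_left_eq_self _ (π / 2)]
  simp_rw [sin_pi_div_two_sub]
  rw [lintegral_cos_mul hg (m := fun u => m (π / 2 - u)) (by fun_prop)]
  refine lintegral_congr fun x => ?_
  congr 2
  rw [ENNReal.tsum_add, ENNReal.tsum_add, add_comm]
  congr 1
  -- Since `arccos x = π / 2 - arcsin x`, the reflection reverses the numbering of the periods: the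
  -- two branches match after `k ↦ -k` and `k ↦ -1 - k`.
  · rw [← (Equiv.neg ℤ).tsum_eq]
    congr 1 with k
    congr 1
    simp only [arccos, Equiv.neg_apply, Int.cast_neg]
    ring
  · rw [← (Equiv.subLeft (-1 : ℤ)).tsum_eq]
    congr 1 with k
    congr 1
    simp only [arccos, Equiv.subLeft_apply, Int.cast_sub, Int.cast_neg, Int.cast_one]
    ring

end ChangeOfVariables

/-! ### Convergence, sign and measurability of the density series. -/

section Series

variable {c lam : ℝ}

/-- `muCut` vanishes outside `(-c t, c t)`, so only finitely many translates contribute. -/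
lemma summable_muCut (c lam t a : ℝ) :
    Summable fun k : ℤ => muCut c lam (a + k * (2 * π)) t := by
  refine summable_of_hasFiniteSupport ?_
  refine (Set.finite_Icc ⌊(-(c * t) - a) / (2 * π)⌋ ⌈(c * t - a) / (2 * π)⌉).subset fun k hk => ?_
  have hk' : |a + k * (2 * π)| < c * t := by
    by_contra h
    exact hk (muCut_of_le (not_lt.1 h))
  rw [abs_lt] at hk'
  refine ⟨Int.floor_le_iff.2 ?_, Int.le_ceil_iff.2 ?_⟩
  · rw [div_lt_iff₀ two_pi_pos]
    linarith [two_pi_pos]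
  · rw [lt_div_iff₀ two_pi_pos]
    linarith [two_pi_pos]

lemma summable_nuTerm (c lam x t : ℝ) : Summable (nuTerm c lam x t) := by
  have h1 := summable_muCut c lam t (2 * π - arccos x)
  have h2 := summable_muCut c lam t (arccos x)
  convert h1.add h2 using 2 with k
  rw [nuTerm]
  ring_nf

lemma summable_etaTerm (c lam x t : ℝ) : Summable (etaTerm c lam x t) := by
  have h1 := summable_muCut c lam t (arcsin x)
  have h2 := summable_muCut c lam t (π - arcsin x)
  convert h1.add h2 using 2 with k
  rw [etaTerm]
  ring_nf

lemma nuTerm_nonneg (hc : 0 < c) (hlam : 0 < lam) (x t : ℝ) (k : ℤ) : 0 ≤ nuTerm c lam x t k :=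
  add_nonneg (muCut_nonneg hc hlam _ _) (muCut_nonneg hc hlam _ _)

lemma etaTerm_nonneg (hc : 0 < c) (hlam : 0 < lam) (x t : ℝ) (k : ℤ) : 0 ≤ etaTerm c lam x t k :=
  add_nonneg (muCut_nonneg hc hlam _ _) (muCut_nonneg hc hlam _ _)

lemma nu_nonneg (hc : 0 < c) (hlam : 0 < lam) (x t : ℝ) : 0 ≤ nu c lam x t :=
  mul_nonneg (by positivity) (tsum_nonneg (nuTerm_nonneg hc hlam x t))

lemma eta_nonneg (hc : 0 < c) (hlam : 0 < lam) (x t : ℝ) : 0 ≤ eta c lam x t :=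
  mul_nonneg (by positivity) (tsum_nonneg (etaTerm_nonneg hc hlam x t))

lemma ofReal_nu (hc : 0 < c) (hlam : 0 < lam) (x t : ℝ) :
    ENNReal.ofReal (nu c lam x t) = ENNReal.ofReal (1 / √(1 - x ^ 2)) *
      ∑' k : ℤ, (ENNReal.ofReal (muCut c lam ((2 * k + 2) * π - arccos x) t) +
        ENNReal.ofReal (muCut c lam (arccos x + 2 * k * π) t)) := by
  rw [nu, ENNReal.ofReal_mul (by positivity),
    ENNReal.ofReal_tsum_of_nonneg (nuTerm_nonneg hc hlam x t) (summable_nuTerm c lam x t)]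
  simp_rw [nuTerm, ENNReal.ofReal_add (muCut_nonneg hc hlam _ t) (muCut_nonneg hc hlam _ t)]

lemma ofReal_eta (hc : 0 < c) (hlam : 0 < lam) (x t : ℝ) :
    ENNReal.ofReal (eta c lam x t) = ENNReal.ofReal (1 / √(1 - x ^ 2)) *
      ∑' k : ℤ, (ENNReal.ofReal (muCut c lam (arcsin x + 2 * k * π) t) +
        ENNReal.ofReal (muCut c lam ((2 * k + 1) * π - arcsin x) t)) := by
  rw [eta, ENNReal.ofReal_mul (by positivity),
    ENNReal.ofReal_tsum_of_nonneg (etaTerm_nonneg hc hlam x t) (summable_etaTerm c lam x t)]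
  simp_rw [etaTerm, ENNReal.ofReal_add (muCut_nonneg hc hlam _ t) (muCut_nonneg hc hlam _ t)]

lemma measurable_nu (c lam t : ℝ) : Measurable fun x => nu c lam x t := by
  have hm := measurable_muCut c lam t
  refine Measurable.mul (by fun_prop) (Measurable.tsum fun k => ?_)
  exact (hm.comp (by fun_prop : Measurable fun x => (2 * k + 2) * π - arccos x)).add
    (hm.comp (by fun_prop : Measurable fun x => arccos x + 2 * k * π))

lemma measurable_eta (c lam t : ℝ) : Measurable fun x => eta c lam x t := by
  have hm := measurable_muCut c lam t
  refine Measurable.mul (by fun_prop) (Measurable.tsum fun k => ?_)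
  exact (hm.comp (by fun_prop : Measurable fun x => arcsin x + 2 * k * π)).add
    (hm.comp (by fun_prop : Measurable fun x => (2 * k + 1) * π - arcsin x))

end Series

/-! ### Images of the atoms and of the absolutely continuous part. -/

section Pushforward

variable {c lam t : ℝ} {φ f : ℝ → ℝ}

/-- Testing with `g = 1` identifies the integral of `f` with the mass of the absolutely continuous
part of `law`, which is finite. -/
lemma integrableOn_of_lintegral_comp_muCut [IsProbabilityMeasure (law c lam t)]
    (hf : Measurable f) (hf0 : ∀ x, 0 ≤ f x)
    (h : ∀ g : ℝ → ℝ≥0∞, Measurable g →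
      ∫⁻ u, g (φ u) * ENNReal.ofReal (muCut c lam u t) =
        ∫⁻ x in Set.Ioo (-1) 1, g x * ENNReal.ofReal (f x)) :
    IntegrableOn f (Set.Ioo (-1) 1) := by
  refine ⟨hf.aestronglyMeasurable, ?_⟩
  rw [hasFiniteIntegral_iff_ofReal (Filter.Eventually.of_forall hf0)]
  have h1 := h (fun _ => 1) measurable_const
  simp only [one_mul] at h1
  rw [← h1]
  calc ∫⁻ u, ENNReal.ofReal (muCut c lam u t)
      = volume.withDensity (fun u => ENNReal.ofReal (muCut c lam u t)) Set.univ := by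
        rw [withDensity_apply _ MeasurableSet.univ, setLIntegral_univ]
    _ ≤ law c lam t Set.univ := by
        rw [law, Measure.add_apply]
        exact le_add_self
    _ < ∞ := measure_lt_top _ _

lemma hasLaw_law_of_lintegral_comp_muCut (hφ : Measurable φ) (hf : Measurable f)
    (h : ∀ g : ℝ → ℝ≥0∞, Measurable g →
      ∫⁻ u, g (φ u) * ENNReal.ofReal (muCut c lam u t) =
        ∫⁻ x in Set.Ioo (-1) 1, g x * ENNReal.ofReal (f x)) :
    HasLaw φ (ENNReal.ofReal (exp (-lam * t) / 2) •
      (Measure.dirac (φ (-(c * t))) + Measure.dirac (φ (c * t))) + densityMeasure f)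
      (law c lam t) := by
  refine ⟨hφ.aemeasurable, Measure.ext_of_lintegral _ fun g hg => ?_⟩
  rw [lintegral_map hg hφ, law, lintegral_add_measure, lintegral_add_measure,
    lintegral_smul_measure, lintegral_smul_measure, lintegral_add_measure, lintegral_add_measure,
    lintegral_dirac' _ (by fun_prop), lintegral_dirac' _ (by fun_prop), lintegral_dirac' _ hg,
    lintegral_dirac' _ hg, densityMeasure, withDensity_indicator measurableSet_Ioo,
    lintegral_withDensity_eq_lintegral_mul _ (by fun_prop) (by fun_prop),
    lintegral_withDensity_eq_lintegral_mul _ (by fun_prop) hg]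
  congr 1
  simp only [Pi.mul_apply, mul_comm (ENNReal.ofReal _)]
  exact h g hg

end Pushforward

end

end Telegraph

/-! ### Assembly. -/

theorem theorem5 {Ω : Type*} [MeasurableSpace Ω] (P : Measure Ω) [IsProbabilityMeasure P]
    (c lam : ℝ) (hc : 0 < c) (hlam : 0 < lam) (V₀ : Ω → ℝ) (τ : ℕ → Ω → ℝ)
    (hdriver : Telegraph.IsDriver P c lam V₀ τ) (t : ℝ) (ht : 0 ≤ t) :
    -- the law of the telegraph process
    HasLaw (Telegraph.position V₀ τ t) (Telegraph.law c lam t) P ∧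
    -- 1) the distribution function of `Z₁ t`
    (∀ x ∈ Set.Icc (-1 : ℝ) 1, (x ≠ cos (c * t) ∨ x = 1) →
      HasSum (fun k : ℤ =>
          Telegraph.positionCDF P V₀ τ ((2 * k + 2) * π - arccos x) t -
            Telegraph.positionCDF P V₀ τ (arccos x + 2 * k * π) t)
        (P.real {ω | Telegraph.oscillatorCos V₀ τ t ω ≤ x})) ∧
    (∀ x ∈ Set.Ico (-1 : ℝ) 1,
      HasSum (fun k : ℤ =>
          Telegraph.positionCDF P V₀ τ ((2 * k + 2) * π - arccos x) t -
            Telegraph.positionCDFLeft P V₀ τ (arccos x + 2 * k * π) t)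
        (P.real {ω | Telegraph.oscillatorCos V₀ τ t ω ≤ x})) ∧
    -- the law of `Z₁ t`
    (∀ x ∈ Set.Ioo (-1 : ℝ) 1, Summable (Telegraph.nuTerm c lam x t) ∧
      0 ≤ Telegraph.nu c lam x t) ∧
    IntegrableOn (fun x => Telegraph.nu c lam x t) (Set.Ioo (-1) 1) ∧
    HasLaw (Telegraph.oscillatorCos V₀ τ t)
      (ENNReal.ofReal (exp (-lam * t)) • Measure.dirac (cos (c * t)) +
        Telegraph.densityMeasure (fun x => Telegraph.nu c lam x t)) P ∧
    -- 2) the distribution function of `Z₂ t`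
    (∀ x ∈ Set.Icc (-1 : ℝ) 1,
      ((x ≠ sin (c * t) ∧ x ≠ -sin (c * t)) ∨ 0 < cos (c * t) ∨ x = 1) →
      HasSum (fun k : ℤ =>
          Telegraph.positionCDF P V₀ τ (arcsin x + 2 * k * π) t -
            Telegraph.positionCDF P V₀ τ ((2 * k - 1 / 2) * π) t +
            Telegraph.positionCDF P V₀ τ ((2 * k + 3 / 2) * π) t -
            Telegraph.positionCDF P V₀ τ ((2 * k + 1) * π - arcsin x) t)
        (P.real {ω | Telegraph.oscillatorSin V₀ τ t ω ≤ x})) ∧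
    (∀ x ∈ Set.Ico (-1 : ℝ) 1,
      HasSum (fun k : ℤ =>
          Telegraph.positionCDF P V₀ τ (arcsin x + 2 * k * π) t -
            Telegraph.positionCDF P V₀ τ ((2 * k - 1 / 2) * π) t +
            Telegraph.positionCDF P V₀ τ ((2 * k + 3 / 2) * π) t -
            Telegraph.positionCDFLeft P V₀ τ ((2 * k + 1) * π - arcsin x) t)
        (P.real {ω | Telegraph.oscillatorSin V₀ τ t ω ≤ x})) ∧
    -- the law of `Z₂ t`
    (∀ x ∈ Set.Ioo (-1 : ℝ) 1, Summable (Telegraph.etaTerm c lam x t) ∧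
      0 ≤ Telegraph.eta c lam x t) ∧
    IntegrableOn (fun x => Telegraph.eta c lam x t) (Set.Ioo (-1) 1) ∧
    HasLaw (Telegraph.oscillatorSin V₀ τ t)
      (ENNReal.ofReal (exp (-lam * t) / 2) •
          (Measure.dirac (sin (c * t)) + Measure.dirac (-sin (c * t))) +
        Telegraph.densityMeasure (fun x => Telegraph.eta c lam x t)) P := by
  have hX := hdriver.hasLaw_position hc hlam ht
  have hν : IsProbabilityMeasure (Telegraph.law c lam t) :=
    hX.isProbabilityMeasure_iff.1 inferInstance
  have hcdf : ∀ x, Telegraph.positionCDF P V₀ τ x t = cdf (Telegraph.law c lam t) x := fun x => by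
    rw [Telegraph.positionCDF, hX.map_eq]
  have hleft : ∀ x, Telegraph.positionCDFLeft P V₀ τ x t =
      Function.leftLim (cdf (Telegraph.law c lam t)) x := fun x => by
    simp_rw [Telegraph.positionCDFLeft, hcdf]
  have hcosP : ∀ x, P.real {ω | Telegraph.oscillatorCos V₀ τ t ω ≤ x} =
      (Telegraph.law c lam t).real {u | cos u ≤ x} := fun x =>
    hX.measureReal_eq (p := fun u => cos u ≤ x) (measurableSet_le (by fun_prop) (by fun_prop))
  have hsinP : ∀ x, P.real {ω | Telegraph.oscillatorSin V₀ τ t ω ≤ x} =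
      (Telegraph.law c lam t).real {u | sin u ≤ x} := fun x =>
    hX.measureReal_eq (p := fun u => sin u ≤ x) (measurableSet_le (by fun_prop) (by fun_prop))
  have hmu : Measurable fun u => ENNReal.ofReal (Telegraph.muCut c lam u t) := by fun_prop
  have hcosI : ∀ g : ℝ → ENNReal, Measurable g →
      ∫⁻ u, g (cos u) * ENNReal.ofReal (Telegraph.muCut c lam u t) =
        ∫⁻ x in Set.Ioo (-1) 1, g x * ENNReal.ofReal (Telegraph.nu c lam x t) := fun g hg => by
    simp_rw [Telegraph.ofReal_nu hc hlam]
    exact Telegraph.lintegral_cos_mul hg hmu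
  have hsinI : ∀ g : ℝ → ENNReal, Measurable g →
      ∫⁻ u, g (sin u) * ENNReal.ofReal (Telegraph.muCut c lam u t) =
        ∫⁻ x in Set.Ioo (-1) 1, g x * ENNReal.ofReal (Telegraph.eta c lam x t) := fun g hg => by
    simp_rw [Telegraph.ofReal_eta hc hlam]
    exact Telegraph.lintegral_sin_mul hg hmu
  have hnu := Telegraph.measurable_nu c lam t
  have heta := Telegraph.measurable_eta c lam t
  simp_rw [hleft, hcdf, hcosP, hsinP]
  refine ⟨hX, fun x hx h => ?_, fun x hx => Telegraph.hasSum_cdf_cos_left _ hx,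
    fun x _ => ⟨Telegraph.summable_nuTerm c lam x t, Telegraph.nu_nonneg hc hlam x t⟩,
    Telegraph.integrableOn_of_lintegral_comp_muCut hnu (Telegraph.nu_nonneg hc hlam · t) hcosI, ?_,
    fun x hx h => ?_, fun x hx => Telegraph.hasSum_cdf_sin_left _ hx,
    fun x _ => ⟨Telegraph.summable_etaTerm c lam x t, Telegraph.eta_nonneg hc hlam x t⟩,
    Telegraph.integrableOn_of_lintegral_comp_muCut heta (Telegraph.eta_nonneg hc hlam · t) hsinI,
    ?_⟩
  · refine Telegraph.hasSum_cdf_cos _ hx (h.imp_left fun hne k => ?_)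
    -- Every left end has cosine `x`, while both atoms have cosine `cos (c t)`.
    have hk : cos (arccos x + 2 * k * π) = x := by
      rw [show arccos x + 2 * k * π = arccos x + k * (2 * π) by ring, cos_add_int_mul_two_pi,
        cos_arccos hx.1 hx.2]
    refine Telegraph.law_singleton (fun h' => hne ?_) (fun h' => hne ?_)
    · rw [← hk, h', cos_neg]
    · rw [← hk, h']
  · have h := (Telegraph.hasLaw_law_of_lintegral_comp_muCut measurable_cos hnu hcosI).comp hX
    -- Cosine is even, so the two atoms merge and the weight doubles.
    rw [cos_neg, ← two_smul ENNReal (Measure.dirac (cos (c * t))), smul_smul,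
      ← ENNReal.ofReal_ofNat 2, ← ENNReal.ofReal_mul (by positivity),
      div_mul_cancel₀ _ two_ne_zero] at h
    exact h
  · refine Telegraph.hasSum_cdf_sin _ hx ?_
    rw [← or_assoc] at h
    refine h.imp_left fun hne k => ?_
    have hk : (2 * k + 1) * π - arcsin x = π - arcsin x + k * (2 * π) := by ring
    have hs : sin ((2 * k + 1) * π - arcsin x) = x := by
      rw [hk, sin_add_int_mul_two_pi, sin_pi_sub, sin_arcsin hx.1 hx.2]
    -- The left ends lie on the descending branch of `sin`; if `cos (c t) > 0`, neither atom can be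
    -- there, whatever `x` is.
    have hcs : cos ((2 * k + 1) * π - arcsin x) ≤ 0 := by
      rw [hk, cos_add_int_mul_two_pi, cos_pi_sub, neg_nonpos]
      exact cos_arcsin_nonneg x
    refine Telegraph.law_singleton (fun h' => ?_) (fun h' => ?_)
    · rw [h', sin_neg] at hs
      rw [h', cos_neg] at hcs
      exact hne.elim (fun hne => hne.2 hs.symm) fun hpos => hpos.not_ge hcs
    · rw [h'] at hs hcs
      exact hne.elim (fun hne => hne.1 hs.symm) fun hpos => hpos.not_ge hcs
  · have h := (Telegraph.hasLaw_law_of_lintegral_comp_muCut measurable_sin heta hsinI).comp hX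
    rw [sin_neg, add_comm (Measure.dirac _)] at h
    exact h
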